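/- **Theorem.** Let $X$ be an arbitrary topological space (no separation axioms are assumed). Let $\mathcal O$ be the collection of all open covers of $X$ (sets of open subsets of $X$ whose union is $X$), let $\Omega$ be the collection of all $\mathscr U\in\mathcal O$ such that every finite subset of $X$ is contained in a member of $\mathscr U$, and let $\mathcal K$ be the collection of all $\mathscr U\in\mathcal O$ such that every compact subset of $X$ is contained in a member of $\mathscr U$ (in all three cases $X$ itself may be a member of the cover). For collections $\mathcal A,\mathcal B$, the game $\mathsf G_{\mathrm{fin}}(\mathcal A,\mathcal B)$ is played by P1 and P2 as follows: in each round $n\in\omega$, P1 plays $A_n\in\mathcal A$ and P2 answers with a finite set $\mathscr F_n\subseteq A_n$; P2 wins if $\bigcup_{n\in\omega}\mathscr F_n\in\mathcal B$, and P1 wins otherwise. A strategy of P1 determines each $A_n$ from $\mathscr F_0,\dots,\mathscr F_{n-1}$; it is predetermined if $A_n$ depends only on $n$, and constant if $A_n$ is the same for all $n$. A strategy of P2 determines each (legal) $\mathscr F_n$ from $A_0,\dots,A_n$; it is Markov if $\mathscr F_n$ depends only on $A_n$ and $n$. For such games $\mathcal G,\mathcal H$, write $\mathcal G\le^+_{\mathrm{II}}\mathcal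 H$ if all of the following hold: 1. if P2 has a winning Markov strategy in $\mathcal G$, then P2 has one in $\mathcal H$; 2. if P2 has a winning strategy in $\mathcal G$, then P2 has one in $\mathcal H$; 3. if P1 has no winning strategy in $\mathcal G$, then P1 has none in $\mathcal H$; 4. if P1 has no winning predetermined strategy in $\mathcal G$, then P1 has none in $\mathcal H$; 5. if P1 has no constant winning strategy in $\mathcal G$, then P1 has none in $\mathcal H$. Then $$\mathsf G_{\mathrm{fin}}(\mathcal K,\mathcal K)\ \le^+_{\mathrm{II}}\ \mathsf G_{\mathrm{fin}}(\Omega,\Omega)\ \le^+_{\mathrm{II}}\ \mathsf G_{\mathrm{fin}}(\mathcal O,\mathcal O).$$ Moreover, let $\mathsf S_{\mathrm{fin}}(\mathcal A,\mathcal B)$ denote the statement that for all $A_0,A_1,\dots\in\mathcal A$ there are finite $\mathscr F_n\subseteq A_n$ with $\bigcup_{n}\mathscr F_n\in\mathcal B$. Then $\mathsf S_{\mathrm{fin}}(\mathcal K,\mathcal K)\Rightarrow\mathsf S_{\mathrm{fin}}(\Omega,\Omega)\Rightarrow\mathsf S_{\mathrm{fin}}(\mathcal O,\mathcal O)$. Likewise,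 if every $\mathscr U\in\mathcal K$ has a countable subset belonging to $\mathcal K$, then every $\mathscr U\in\Omega$ has a countable subset belonging to $\Omega$; and if the latter holds, then every $\mathscr U\in\mathcal O$ has a countable subset belonging to $\mathcal O$. -/

import Mathlib

universe u v

/-- An open cover of `X`, as a set of subsets of `X`. -/
def IsOpenSetCover (X : Type u) [TopologicalSpace X] (C : Set (Set X)) : Prop :=
  (∀ U ∈ C, IsOpen U) ∧ ⋃₀ C = Set.univ

/-- `𝒪_X`: the open covers of `X`. -/
def OpenCovers (X : Type u) [TopologicalSpace X] : Set (Set (Set X)) :=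
  {C | IsOpenSetCover X C}

/-- `Ω_X`: the open covers such that every finite subset of `X` is contained in a member. -/
def OmegaCovers (X : Type u) [TopologicalSpace X] : Set (Set (Set X)) :=
  {C | IsOpenSetCover X C ∧ ∀ F : Set X, F.Finite → ∃ U ∈ C, F ⊆ U}

/-- `𝒦_X`: the open covers such that every compact subset of `X` is contained in a member. -/
def KCovers (X : Type u) [TopologicalSpace X] : Set (Set (Set X)) :=
  {C | IsOpenSetCover X C ∧ ∀ K : Set X, IsCompact K → ∃ U ∈ C, K ⊆ U}

/-- The finite-selection game `G_fin(𝒜, ℬ)`, given by its two collections. In round `n`, P1 plays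
`A n ∈ 𝒜` and P2 answers with a finite `F n ⊆ A n`; P2 wins when `⋃ n, F n ∈ ℬ`. -/
structure FinSelectionGame (α : Type u) where
  /-- the moves of P1 -/
  moves : Set (Set α)
  /-- the unions with which P2 wins -/
  target : Set (Set α)

/-- The notation `G_fin(𝒜, ℬ)`. -/
def Gfin {α : Type u} (A B : Set (Set α)) : FinSelectionGame α := ⟨A, B⟩

namespace FinSelectionGame

variable {α : Type u} (G : FinSelectionGame α)

/-- The choices `F n` of P2 obey the rules when P1 plays `A n`. -/
def Legal (A : ℕ → G.moves) (F : ℕ → Finset α) : Prop :=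
  ∀ n, (F n : Set α) ⊆ (A n : Set α)

/-- P2 wins a run with choices `F n`. -/
def WonByII (F : ℕ → Finset α) : Prop :=
  (⋃ n, (F n : Set α)) ∈ G.target

/-- The finite sequence `⟨x 0, …, x (n - 1)⟩`. -/
def initSeg {β : Type v} (x : ℕ → β) (n : ℕ) : List β := (List.range n).map x

/-- P1 has a winning strategy: a move of P1 depends on all earlier choices of P2. -/
def IWins : Prop :=
  ∃ σ : List (Finset α) → G.moves, ∀ F : ℕ → Finset α,
    G.Legal (fun n => σ (initSeg F n)) F → ¬ G.WonByII F

/-- P1 has a winning predetermined strategy: a move of P1 depends on the turn number only. -/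
def IWinsPre : Prop :=
  ∃ σ : ℕ → G.moves, ∀ F : ℕ → Finset α, G.Legal σ F → ¬ G.WonByII F

/-- P1 has a constant winning strategy. -/
def IWinsCnst : Prop :=
  ∃ A₀ : G.moves, ∀ F : ℕ → Finset α, G.Legal (fun _ => A₀) F → ¬ G.WonByII F

/-- P2 has a winning strategy: the choice in round `n` depends on `A 0, …, A n`. -/
def IIWins : Prop :=
  ∃ σ : List G.moves → Finset α, ∀ A : ℕ → G.moves,
    G.Legal A (fun n => σ (initSeg A (n + 1))) ∧ G.WonByII (fun n => σ (initSeg A (n + 1)))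

/-- P2 has a winning Markov strategy: the choice in round `n` depends on `A n` and `n` only. -/
def IIWinsMark : Prop :=
  ∃ σ : G.moves → ℕ → Finset α, ∀ A : ℕ → G.moves,
    G.Legal A (fun n => σ (A n) n) ∧ G.WonByII (fun n => σ (A n) n)

/-- `G ≤_II H`: winning plays for P2 transfer from `G` to `H`. -/
structure LeII {α : Type u} {β : Type v} (G : FinSelectionGame α) (H : FinSelectionGame β) :
    Prop where
  mark : G.IIWinsMark → H.IIWinsMark
  strat : G.IIWins → H.IIWins
  notI : ¬ G.IWins → ¬ H.IWins
  notPre : ¬ G.IWinsPre → ¬ H.IWinsPre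

/-- `G ≤⁺_II H`: as `G ≤_II H`, also at the level of constant strategies of P1. -/
structure LeIIPlus {α : Type u} {β : Type v} (G : FinSelectionGame α) (H : FinSelectionGame β) :
    Prop extends LeII G H where
  notCnst : ¬ G.IWinsCnst → ¬ H.IWinsCnst

end FinSelectionGame

/-- The selection principle `S_fin(𝒜, ℬ)`. -/
def Sfin {α : Type u} (A B : Set (Set α)) : Prop :=
  ∀ a : ℕ → Set α, (∀ n, a n ∈ A) →
    ∃ F : ℕ → Finset α, (∀ n, (F n : Set α) ⊆ a n) ∧ (⋃ n, (F n : Set α)) ∈ B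

/-- Every member of `𝒜` has a countable subset that belongs to `𝒜`. For `𝒪_X`, `Ω_X`, `𝒦_X` this
says that `X` is Lindelöf, `ω`-Lindelöf, `k`-Lindelöf. -/
def LindelofFor {α : Type u} (A : Set (Set α)) : Prop :=
  ∀ a ∈ A, ∃ b ⊆ a, b.Countable ∧ b ∈ A

/-!
`𝒦 ≤ Ω`: when P1 plays an ω-cover `C` in round `n`, P2 pretends that P1 has played the family of
open sets `V` all of whose subsets with at most `n` points lie in members of a finite part of `C`.
By compactness of `Kⁿ` and the tube lemma in `Xⁿ`, this family is a k-cover. Each `V` that P2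
chooses in the k-cover game is then replaced by its finite part, which takes care of a finite set
`S ⊆ V` as soon as `n ≥ |S|`. If no chosen `V` is the whole space, then `S` lies in chosen sets `V`
of arbitrarily late rounds, and if `X` is not compact, then `X` may be deleted from the k-covers.
If `X` is compact, then P2 wins the ω-cover game by answering with a finite part that belongs to
`V = X`.

`Ω ≤ 𝒪`: the finite unions of members of an open cover form a k-cover, so an ω-cover. This
translation is the same in every round, hence it preserves constant strategies. For `𝒦 ≤ Ω` it is
not, and the constant strategies are treated through the Lindelöf property, which says that P1 has
no winning one.
-/

open Set Filter Topology

section TubeLemma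

theorem exists_mem_ultrafilter_le_nhds {X : Type u} [TopologicalSpace X] {K : Set X}
    (hK : IsCompact K) {g : Ultrafilter X} (hg : ↑g ≤ 𝓝ˢ K) : ∃ x ∈ K, ↑g ≤ 𝓝 x := by
  by_contra! h
  have hdisj : Disjoint (𝓝ˢ K) (g : Filter X) :=
    hK.disjoint_nhdsSet_left.2 fun x hx => (Ultrafilter.disjoint_iff_not_le.2 (h x hx)).symm
  exact g.neBot.ne (disjoint_self.1 (hdisj.mono_left hg))

theorem pi_nhdsSet_le_nhdsSet_pi {ι : Type u} {X : ι → Type v}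
    [∀ i, TopologicalSpace (X i)] {K : ∀ i, Set (X i)} (hK : ∀ i, IsCompact (K i)) :
    Filter.pi (fun i => 𝓝ˢ (K i)) ≤ 𝓝ˢ (univ.pi K) := by
  refine le_iff_ultrafilter.2 fun g hg => ?_
  have hlim : ∀ i, ∃ x ∈ K i, ↑(g.map (Function.eval i)) ≤ 𝓝 x := fun i =>
    exists_mem_ultrafilter_le_nhds (hK i) (le_pi.1 hg i)
  choose x hxK hx using hlim
  calc
    (g : Filter (∀ i, X i)) ≤ 𝓝 x := by rw [nhds_pi]; exact le_pi.2 hx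
    _ ≤ 𝓝ˢ (univ.pi K) := nhds_le_nhdsSet fun i _ => hxK i

theorem exists_isOpen_univ_pi_subset {ι : Type u} {X : Type v} [TopologicalSpace X] {K : Set X}
    (hK : IsCompact K) {O : Set (ι → X)} (hO : IsOpen O) (hKO : (univ.pi fun _ => K) ⊆ O) :
    ∃ V, IsOpen V ∧ K ⊆ V ∧ (univ.pi fun _ => V) ⊆ O := by
  have hmem : O ∈ Filter.pi fun _ : ι => 𝓝ˢ K :=
    pi_nhdsSet_le_nhdsSet_pi (fun _ => hK) (hO.mem_nhdsSet.2 hKO)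
  obtain ⟨⟨I, V⟩, ⟨-, hV, hKV⟩, hVO⟩ := (hasBasis_nhdsSet K).pi_self.mem_iff.1 hmem
  exact ⟨V, hV, hKV, fun x hx => hVO fun i _ => hx i trivial⟩

end TubeLemma

theorem exists_fin_range_eq {α : Type u} {S : Finset α} (hS : S.Nonempty) {n : ℕ}
    (hn : S.card ≤ n) : ∃ x : Fin n → α, range x = S := by
  have := hS.to_subtype
  obtain ⟨e⟩ : Nonempty (S ↪ Fin n) := Function.Embedding.nonempty_of_card_le (by simpa using hn)
  refine ⟨(↑) ∘ Function.invFun e, ?_⟩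
  simpa using (Function.invFun_surjective e.injective).range_comp ((↑) : S → α)

section Captures

variable {X : Type u}

/-- Every subset of `V` with at most `n` points lies in a member of `C`. For `V` the whole space and
all `n`, this is the defining condition of an ω-cover. -/
def CapturesSubsets (n : ℕ) (C : Set (Set X)) (V : Set X) : Prop :=
  ∀ S : Finset X, S.card ≤ n → (S : Set X) ⊆ V → ∃ W ∈ C, (S : Set X) ⊆ W

theorem CapturesSubsets.mono {n : ℕ} {C : Set (Set X)} {V W : Set X} (hV : CapturesSubsets n C V)
    (hWV : W ⊆ V) : CapturesSubsets n C W :=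
  fun S hS hSW => hV S hS (hSW.trans hWV)

variable [TopologicalSpace X]

theorem CapturesSubsets.exists_finset_of_isCompact {n : ℕ} {C : Set (Set X)} {K : Set X}
    (hCK : CapturesSubsets n C K) (hC : ∀ U ∈ C, IsOpen U) (hK : IsCompact K) :
    ∃ V, IsOpen V ∧ K ⊆ V ∧ ∃ F : Finset (Set X), (F : Set (Set X)) ⊆ C ∧
      CapturesSubsets n (F : Set (Set X)) V := by
  classical
  obtain ⟨W, hW, -⟩ := hCK ∅ (by simp) (by simp)
  have hopen : ∀ U ∈ C, IsOpen (univ.pi fun _ : Fin n => U) := fun U hU =>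
    isOpen_set_pi finite_univ fun _ _ => hC U hU
  have hcover : (univ.pi fun _ : Fin n => K) ⊆ ⋃ U ∈ C, univ.pi fun _ => U := by
    intro x hx
    obtain ⟨U, hU, hxU⟩ := hCK (Finset.univ.image x)
      (Finset.card_image_le.trans (by simp)) (by simpa [range_subset_iff] using hx)
    exact mem_biUnion hU fun i _ => hxU (by simp)
  obtain ⟨b, hbC, hb, hKb⟩ :=
    (isCompact_univ_pi fun _ => hK).elim_finite_subcover_image hopen hcover
  obtain ⟨V, hV, hKV, hVb⟩ :=
    exists_isOpen_univ_pi_subset hK (isOpen_biUnion fun U hU => hopen U (hbC hU)) hKb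
  refine ⟨V, hV, hKV, insert W hb.toFinset, ?_, fun S hS hSV => ?_⟩
  · simpa [insert_subset_iff] using ⟨hW, hbC⟩
  · rcases S.eq_empty_or_nonempty with rfl | hne
    · exact ⟨W, by simp, by simp⟩
    · obtain ⟨x, hx⟩ := exists_fin_range_eq hne hS
      rw [← hx, range_subset_iff] at hSV
      obtain ⟨U, hU, hxU⟩ := mem_iUnion₂.1 (hVb fun i _ => hSV i)
      exact ⟨U, by simp [hU], hx ▸ range_subset_iff.2 fun i => hxU i trivial⟩

/-- The open sets whose subsets with at most `n` points are captured by finitely many members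
of `C`: what P2 pretends that P1 has played in round `n` instead of the ω-cover `C`. -/
def finitelyCaptured (n : ℕ) (C : Set (Set X)) : Set (Set X) :=
  {V | IsOpen V ∧ ∃ F : Finset (Set X), (F : Set (Set X)) ⊆ C ∧
    CapturesSubsets n (F : Set (Set X)) V}

theorem mem_finitelyCaptured_of_subset {n : ℕ} {C : Set (Set X)} {V W : Set X}
    (hV : V ∈ finitelyCaptured n C) (hW : IsOpen W) (hWV : W ⊆ V) : W ∈ finitelyCaptured n C := by
  obtain ⟨-, F, hFC, hF⟩ := hV
  exact ⟨hW, F, hFC, hF.mono hWV⟩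

end Captures

section Covers

variable {X : Type u}

/-- The unions of finitely many members of `C`, the empty union included: what P2 pretends that P1
has played instead of the open cover `C`. -/
def finiteUnions (C : Set (Set X)) : Set (Set X) :=
  {V | ∃ F : Finset (Set X), (F : Set (Set X)) ⊆ C ∧ V = ⋃₀ (F : Set (Set X))}

variable [TopologicalSpace X] {C : Set (Set X)}

theorem mem_omegaCovers_iff : C ∈ OmegaCovers X ↔
    (∀ U ∈ C, IsOpen U) ∧ ∀ S : Finset X, ∃ U ∈ C, (S : Set X) ⊆ U := by
  refine ⟨fun hC => ⟨hC.1.1, fun S => hC.2 S S.finite_toSet⟩, fun ⟨hopen, h⟩ =>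
    ⟨⟨hopen, eq_univ_of_forall fun x => ?_⟩, fun F hF => by simpa using h hF.toFinset⟩⟩
  obtain ⟨U, hU, hx⟩ := h {x}
  exact ⟨U, hU, by simpa using hx⟩

theorem mem_kCovers_iff : C ∈ KCovers X ↔
    (∀ U ∈ C, IsOpen U) ∧ ∀ K : Set X, IsCompact K → ∃ U ∈ C, K ⊆ U := by
  refine ⟨fun hC => ⟨hC.1.1, hC.2⟩, fun ⟨hopen, h⟩ =>
    ⟨⟨hopen, eq_univ_of_forall fun x => ?_⟩, h⟩⟩
  obtain ⟨U, hU, hx⟩ := h {x} isCompact_singleton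
  exact ⟨U, hU, hx rfl⟩

theorem kCovers_subset_omegaCovers : KCovers X ⊆ OmegaCovers X :=
  fun _ hC => ⟨hC.1, fun F hF => hC.2 F hF.isCompact⟩

theorem diff_mem_omegaCovers (hC : C ∈ OmegaCovers X) {E : Set (Set X)} (hE : E.Finite)
    (hE_univ : univ ∉ E) : C \ E ∈ OmegaCovers X := by
  have hmissed : ∀ V : E, ∃ x, x ∉ (V : Set X) := fun V =>
    (ne_univ_iff_exists_notMem _).1 fun h => hE_univ (h ▸ V.2)
  choose p hp using hmissed
  have := hE.to_subtype
  refine mem_omegaCovers_iff.2 ⟨fun U hU => hC.1.1 U hU.1, fun S => ?_⟩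
  obtain ⟨U, hU, hSU⟩ := hC.2 (S ∪ range p) (S.finite_toSet.union (finite_range p))
  exact ⟨U, ⟨hU, fun hUE => hp ⟨U, hUE⟩ (hSU (.inr ⟨_, rfl⟩))⟩, subset_union_left.trans hSU⟩

theorem exists_ge_exists_mem_superset {F : ℕ → Finset (Set X)} (hF : ∀ n, univ ∉ F n)
    (hΩ : (⋃ n, (F n : Set (Set X))) ∈ OmegaCovers X) (m : ℕ) (S : Finset X) :
    ∃ n ≥ m, ∃ V ∈ F n, (S : Set X) ⊆ V := by
  have hfin : (⋃ n ∈ Iio m, (F n : Set (Set X))).Finite :=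
    (finite_Iio m).biUnion fun n _ => (F n).finite_toSet
  obtain ⟨V, ⟨hV, hVm⟩, hSV⟩ := (diff_mem_omegaCovers hΩ hfin (by simp [hF])).2 S S.finite_toSet
  obtain ⟨n, hn⟩ := mem_iUnion.1 hV
  exact ⟨n, not_lt.1 fun hlt => hVm (mem_biUnion hlt hn), V, hn, hSV⟩

theorem exists_isOpen_superset_ne_univ [NoncompactSpace X] {K : Set X} (hK : IsCompact K) :
    ∃ W, IsOpen W ∧ K ⊆ W ∧ W ≠ univ := by
  by_contra! h
  refine noncompact_univ X (isCompact_of_finite_subcover fun U hU hcov => ?_)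
  obtain ⟨t, ht⟩ := hK.elim_finite_subcover U hU ((subset_univ K).trans hcov)
  exact ⟨t, (h _ (isOpen_biUnion fun i _ => hU i) ht).ge⟩

theorem diff_univ_mem_kCovers [NoncompactSpace X] (hC : C ∈ KCovers X)
    (hdown : ∀ V ∈ C, ∀ W, IsOpen W → W ⊆ V → W ∈ C) : C \ {univ} ∈ KCovers X := by
  refine mem_kCovers_iff.2 ⟨fun U hU => hC.1.1 U hU.1, fun K hK => ?_⟩
  obtain ⟨V, hV, hKV⟩ := hC.2 K hK
  obtain ⟨W, hW, hKW, hne⟩ := exists_isOpen_superset_ne_univ hK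
  exact ⟨V ∩ W, ⟨hdown V hV _ ((hC.1.1 V hV).inter hW) inter_subset_left,
    fun h => hne (univ_subset_iff.1 (h.ge.trans inter_subset_right))⟩, subset_inter hKV hKW⟩

theorem finitelyCaptured_mem_kCovers (hC : C ∈ OmegaCovers X) (n : ℕ) :
    finitelyCaptured n C ∈ KCovers X := by
  refine mem_kCovers_iff.2 ⟨fun V hV => hV.1, fun K hK => ?_⟩
  have hCK : CapturesSubsets n C K := fun S _ _ => hC.2 S S.finite_toSet
  obtain ⟨V, hV, hKV, hF⟩ := hCK.exists_finset_of_isCompact hC.1.1 hK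
  exact ⟨V, ⟨hV, hF⟩, hKV⟩

theorem finitelyCaptured_diff_univ_mem_kCovers [NoncompactSpace X] (hC : C ∈ OmegaCovers X)
    (n : ℕ) : finitelyCaptured n C \ {univ} ∈ KCovers X :=
  diff_univ_mem_kCovers (finitelyCaptured_mem_kCovers hC n)
    fun _ hV _ => mem_finitelyCaptured_of_subset hV

theorem finiteUnions_mem_kCovers (hC : C ∈ OpenCovers X) : finiteUnions C ∈ KCovers X := by
  refine mem_kCovers_iff.2 ⟨?_, fun K hK => ?_⟩
  · rintro _ ⟨F, hF, rfl⟩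
    exact isOpen_sUnion fun U hU => hC.1 U (hF hU)
  · have hcov : K ⊆ ⋃ U ∈ C, U := by simp [← sUnion_eq_biUnion, hC.2]
    obtain ⟨b, hbC, hb, hKb⟩ := hK.elim_finite_subcover_image hC.1 hcov
    exact ⟨_, ⟨hb.toFinset, by simpa using hbC, rfl⟩, by simpa [sUnion_eq_biUnion] using hKb⟩

end Covers

namespace FinSelectionGame

section InitSeg

variable {α : Type u} {β : Type v}

theorem initSeg_succ (x : ℕ → β) (n : ℕ) : initSeg x (n + 1) = initSeg x n ++ [x n] := by
  simp [initSeg, List.range_succ]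

theorem length_initSeg (x : ℕ → β) (n : ℕ) : (initSeg x n).length = n := by
  simp [initSeg]

theorem map_initSeg (f : β → α) (x : ℕ → β) (n : ℕ) :
    (initSeg x n).map f = initSeg (fun k => f (x k)) n := by
  simp [initSeg]

theorem mapIdx_initSeg (f : ℕ → β → α) (x : ℕ → β) (n : ℕ) :
    (initSeg x n).mapIdx f = initSeg (fun k => f k (x k)) n := by
  induction n with
  | zero => rfl
  | succ n ih => rw [initSeg_succ, List.mapIdx_concat, ih, length_initSeg, initSeg_succ]

theorem exists_forall_eq_apply_initSeg (s : List β → β) :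
    ∃ x : ℕ → β, ∀ n, x n = s (initSeg x n) := by
  let h : ℕ → List β := fun n => n.rec [] fun _ L => L ++ [s L]
  have hh : ∀ n, initSeg (fun k => s (h k)) n = h n := by
    intro n
    induction n with
    | zero => rfl
    | succ n ih => rw [initSeg_succ, ih]
  exact ⟨fun n => s (h n), fun n => by rw [hh]⟩

end InitSeg

section Strategies

variable {α : Type u} {G : FinSelectionGame α}

theorem IIWins.of_forall_initSeg (σ : List G.moves → G.moves → Finset α)
    (hσ : ∀ A : ℕ → G.moves, G.Legal A (fun n => σ (initSeg A n) (A n)) ∧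
      G.WonByII (fun n => σ (initSeg A n) (A n))) : G.IIWins :=
  ⟨fun L => L.getLast?.elim ∅ (σ L.dropLast), fun A => by simpa [initSeg_succ] using hσ A⟩

theorem IIWinsMark.iiWins (h : G.IIWinsMark) : G.IIWins := by
  obtain ⟨σ, hσ⟩ := h
  exact .of_forall_initSeg (fun L a => σ a L.length) fun A => by
    simpa only [length_initSeg] using hσ A

theorem IWinsPre.iWins (h : G.IWinsPre) : G.IWins := by
  obtain ⟨σ, hσ⟩ := h
  exact ⟨fun L => σ L.length, fun F hF => hσ F (by simpa only [length_initSeg] using hF)⟩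

theorem IWinsCnst.iWinsPre (h : G.IWinsCnst) : G.IWinsPre := by
  obtain ⟨A, hA⟩ := h
  exact ⟨fun _ => A, hA⟩

theorem IIWins.not_iWins (h : G.IIWins) : ¬ G.IWins := by
  rintro ⟨σ, hσ⟩
  obtain ⟨μ, hμ⟩ := h
  let round : List (G.moves × Finset α) → G.moves × Finset α := fun L =>
    (σ (L.map Prod.snd), μ (L.map Prod.fst ++ [σ (L.map Prod.snd)]))
  obtain ⟨x, hx⟩ := exists_forall_eq_apply_initSeg round
  have hI : ∀ n, (x n).1 = σ (initSeg (fun k => (x k).2) n) := by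
    intro n
    rw [hx n]
    simp only [round, map_initSeg]
  have hII : ∀ n, (x n).2 = μ (initSeg (fun k => (x k).1) (n + 1)) := by
    intro n
    rw [initSeg_succ, hI n, hx n]
    simp only [round, map_initSeg]
  have hwin := hμ fun n => (x n).1
  simp only [← hII] at hwin
  refine hσ (fun n => (x n).2) ?_ hwin.2
  simpa only [← hI] using hwin.1

end Strategies

section Translation

variable {α : Type u} {β : Type v} {G : FinSelectionGame α} {H : FinSelectionGame β}

/-- A round-by-round translation between `G` and `H`: in round `n`, a move `a` of P1 in `H` becomes
the move `move n a` in `G`, and a legal answer `F` of P2 to it in `G` becomes the answer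
`answer n a F` in `H`, in such a way that runs won by P2 are turned into runs won by P2. -/
structure Translation (G : FinSelectionGame α) (H : FinSelectionGame β) where
  move : ℕ → H.moves → G.moves
  answer : ℕ → H.moves → Finset α → Finset β
  answer_subset : ∀ n a (F : Finset α), (F : Set α) ⊆ (move n a : Set α) →
    (answer n a F : Set β) ⊆ (a : Set β)
  won : ∀ (A : ℕ → H.moves) (F : ℕ → Finset α), G.Legal (fun n => move n (A n)) F →
    G.WonByII F → H.WonByII (fun n => answer n (A n) (F n))

namespace Translation

theorem legal (t : Translation G H) {A : ℕ → H.moves} {F : ℕ → Finset α}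
    (hF : G.Legal (fun n => t.move n (A n)) F) :
    H.Legal A (fun n => t.answer n (A n) (F n)) :=
  fun n => t.answer_subset n (A n) (F n) (hF n)

theorem iiWinsMark (t : Translation G H) (h : G.IIWinsMark) : H.IIWinsMark := by
  obtain ⟨σ, hσ⟩ := h
  refine ⟨fun a n => t.answer n a (σ (t.move n a) n), fun A => ?_⟩
  obtain ⟨hlegal, hwon⟩ := hσ fun n => t.move n (A n)
  exact ⟨t.legal hlegal, t.won A _ hlegal hwon⟩

theorem iiWins (t : Translation G H) (h : G.IIWins) : H.IIWins := by
  obtain ⟨σ, hσ⟩ := h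
  refine .of_forall_initSeg (fun L a => t.answer L.length a
    (σ (L.mapIdx t.move ++ [t.move L.length a]))) fun A => ?_
  obtain ⟨hlegal, hwon⟩ := hσ fun n => t.move n (A n)
  simp only [length_initSeg, mapIdx_initSeg, ← initSeg_succ (fun n => t.move n (A n))]
  exact ⟨t.legal hlegal, t.won A _ hlegal hwon⟩

/-- The answers of P2 in `H` that correspond to the answers `L` of P2 in `G` when P1 follows the
strategy `σ` in `H`. -/
def history (t : Translation G H) (σ : List (Finset β) → H.moves)
    (L : List (Finset α)) : List (Finset β) :=
  L.foldl (fun E F => E ++ [t.answer E.length (σ E) F]) []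

theorem initSeg_history (t : Translation G H) (σ : List (Finset β) → H.moves)
    (F : ℕ → Finset α) (n : ℕ) :
    initSeg (fun k => t.answer k (σ (t.history σ (initSeg F k))) (F k)) n =
      t.history σ (initSeg F n) := by
  induction n with
  | zero => rfl
  | succ n ih =>
    have hlen : (t.history σ (initSeg F n)).length = n := by rw [← ih, length_initSeg]
    rw [initSeg_succ, ih, initSeg_succ F, history, history, List.foldl_concat, ← history, hlen]

theorem iWins (t : Translation G H) (h : H.IWins) : G.IWins := by
  obtain ⟨σ, hσ⟩ := h
  refine ⟨fun L => t.move L.length (σ (t.history σ L)), fun F hF hwon => ?_⟩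
  simp only [length_initSeg] at hF
  refine hσ _ ?_ (t.won (fun n => σ (t.history σ (initSeg F n))) F hF hwon)
  simpa only [initSeg_history] using t.legal hF

theorem iWinsPre (t : Translation G H) (h : H.IWinsPre) : G.IWinsPre := by
  obtain ⟨σ, hσ⟩ := h
  exact ⟨fun n => t.move n (σ n), fun F hF hwon => hσ _ (t.legal hF) (t.won σ F hF hwon)⟩

theorem iWinsCnst (t : Translation G H) (ht : ∀ n, t.move n = t.move 0) (h : H.IWinsCnst) :
    G.IWinsCnst := by
  obtain ⟨A, hA⟩ := h
  refine ⟨t.move 0 A, fun F hF hwon => ?_⟩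
  have hF' : G.Legal (fun n => t.move n A) F := by simpa only [ht] using hF
  exact hA _ (t.legal hF') (t.won (fun _ => A) F hF' hwon)

theorem leII (t : Translation G H) : LeII G H :=
  ⟨t.iiWinsMark, t.iiWins, mt t.iWins, mt t.iWinsPre⟩

theorem leIIPlus (t : Translation G H) (ht : ∀ n, t.move n = t.move 0) : LeIIPlus G H :=
  ⟨t.leII, mt (t.iWinsCnst ht)⟩

end Translation

theorem LeII.of_iiWinsMark (h : H.IIWinsMark) : LeII G H :=
  ⟨fun _ => h, fun _ => h.iiWins, fun _ => h.iiWins.not_iWins,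
    fun _ hI => h.iiWins.not_iWins hI.iWins⟩

end Translation

section SelectionPrinciples

variable {α : Type u} {β : Type v}

theorem not_iWinsPre_iff_sfin {A B : Set (Set α)} : ¬ (Gfin A B).IWinsPre ↔ Sfin A B := by
  constructor
  · intro h a ha
    by_contra hF
    exact h ⟨fun n => ⟨a n, ha n⟩, fun F hlegal hwon => hF ⟨F, hlegal, hwon⟩⟩
  · rintro h ⟨σ, hσ⟩
    obtain ⟨F, hlegal, hwon⟩ := h (fun n => σ n) fun n => (σ n).2
    exact hσ F hlegal hwon

theorem exists_iUnion_finset_eq_of_countable {b : Set α} (hb : b.Countable) :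
    ∃ F : ℕ → Finset α, ⋃ n, (F n : Set α) = b := by
  rcases b.eq_empty_or_nonempty with rfl | hne
  · exact ⟨fun _ => ∅, by simp⟩
  · obtain ⟨f, rfl⟩ := hb.exists_eq_range hne
    exact ⟨fun n => {f n}, by simp [iUnion_singleton_eq_range]⟩

theorem not_iWinsCnst_iff_lindelofFor {A : Set (Set α)} :
    ¬ (Gfin A A).IWinsCnst ↔ LindelofFor A := by
  constructor
  · intro h a ha
    by_contra hb
    exact h ⟨⟨a, ha⟩, fun F hlegal hwon => hb ⟨_, iUnion_subset hlegal,
      countable_iUnion fun n => (F n).countable_toSet, hwon⟩⟩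
  · rintro h ⟨⟨a, ha⟩, hσ⟩
    obtain ⟨b, hba, hb, hbA⟩ := h a ha
    obtain ⟨F, rfl⟩ := exists_iUnion_finset_eq_of_countable hb
    exact hσ F (iUnion_subset_iff.1 hba) hbA

theorem LeII.sfin {A B : Set (Set α)} {C D : Set (Set β)} (h : (Gfin A B).LeII (Gfin C D))
    (hAB : Sfin A B) : Sfin C D :=
  not_iWinsPre_iff_sfin.1 (h.notPre (not_iWinsPre_iff_sfin.2 hAB))

theorem LeIIPlus.lindelofFor {A : Set (Set α)} {B : Set (Set β)}
    (h : (Gfin A A).LeIIPlus (Gfin B B)) (hA : LindelofFor A) : LindelofFor B :=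
  not_iWinsCnst_iff_lindelofFor.1 (h.notCnst (not_iWinsCnst_iff_lindelofFor.2 hA))

end SelectionPrinciples

end FinSelectionGame

open FinSelectionGame

section Comparison

variable {X : Type u} [TopologicalSpace X]

theorem iiWinsMark_gfin_omegaCovers [CompactSpace X] :
    (Gfin (OmegaCovers X) (OmegaCovers X)).IIWinsMark := by
  have hanswer : ∀ (a : (Gfin (OmegaCovers X) (OmegaCovers X)).moves) (n : ℕ),
      ∃ F : Finset (Set X), (F : Set (Set X)) ⊆ a ∧
        CapturesSubsets n (F : Set (Set X)) (univ : Set X) := by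
    intro a n
    obtain ⟨V, ⟨-, hF⟩, hV⟩ := (finitelyCaptured_mem_kCovers a.2 n).2 univ isCompact_univ
    rwa [univ_subset_iff.1 hV] at hF
  choose σ hσ hcaptures using hanswer
  refine ⟨σ, fun A => ⟨fun n => hσ (A n) n, mem_omegaCovers_iff.2 ⟨fun U hU => ?_, fun S => ?_⟩⟩⟩
  · obtain ⟨n, hn⟩ := mem_iUnion.1 hU
    exact (A n).2.1.1 U (hσ _ _ hn)
  · obtain ⟨W, hW, hSW⟩ := hcaptures (A S.card) S.card S le_rfl (subset_univ _)
    exact ⟨W, mem_iUnion.2 ⟨_, hW⟩, hSW⟩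

theorem leII_gfin_kCovers_omegaCovers_of_noncompactSpace [NoncompactSpace X] :
    (Gfin (KCovers X) (KCovers X)).LeII (Gfin (OmegaCovers X) (OmegaCovers X)) := by
  classical
  have hanswer : ∀ (n : ℕ) (a : (Gfin (OmegaCovers X) (OmegaCovers X)).moves),
      ∀ V ∈ finitelyCaptured n a.1 \ {univ}, ∃ F : Finset (Set X), (F : Set (Set X)) ⊆ a ∧
        CapturesSubsets n (F : Set (Set X)) V :=
    fun n a V hV => hV.1.2
  choose! u hua hu using hanswer
  have hlegal : ∀ n a (F : Finset (Set X)), (F : Set (Set X)) ⊆ finitelyCaptured n a.1 \ {univ} →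
      (F.biUnion (u n a) : Set (Set X)) ⊆ a := fun n a F hF => by
    simpa only [Finset.coe_biUnion, iUnion_subset_iff] using fun V hV => hua n a V (hF hV)
  refine Translation.leII
    { move := fun n a =>
        ⟨finitelyCaptured n a.1 \ {univ}, finitelyCaptured_diff_univ_mem_kCovers a.2 n⟩
      answer := fun n a F => F.biUnion (u n a)
      answer_subset := hlegal
      won := fun A F hF hwon => mem_omegaCovers_iff.2 ⟨fun U hU => ?_, fun S => ?_⟩ }
  · obtain ⟨n, hn⟩ := mem_iUnion.1 hU
    exact (A n).2.1.1 U (hlegal n _ _ (hF n) hn)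
  · obtain ⟨n, hn, V, hV, hSV⟩ := exists_ge_exists_mem_superset
      (fun n hn => (hF n hn).2 rfl) (kCovers_subset_omegaCovers hwon) S.card S
    obtain ⟨W, hW, hSW⟩ := hu n (A n) V (hF n hV) S hn hSV
    exact ⟨W, mem_iUnion.2 ⟨n, Finset.mem_biUnion.2 ⟨V, hV, hW⟩⟩, hSW⟩

theorem LindelofFor.omegaCovers_of_kCovers (h : LindelofFor (KCovers X)) :
    LindelofFor (OmegaCovers X) := by
  intro a ha
  choose b hb hbc hbK using fun n => h _ (finitelyCaptured_mem_kCovers ha n)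
  choose F hFa hF using fun n (V : b n) => (hb n V.2).2
  have := fun n => (hbc n).to_subtype
  have hsub : (⋃ n, ⋃ V, (F n V : Set (Set X))) ⊆ a := iUnion₂_subset hFa
  refine ⟨_, hsub, countable_iUnion fun n => countable_iUnion fun V => (F n V).countable_toSet,
    mem_omegaCovers_iff.2 ⟨fun U hU => ha.1.1 U (hsub hU), fun S => ?_⟩⟩
  obtain ⟨V, hV, hSV⟩ := (hbK S.card).2 S S.finite_toSet.isCompact
  obtain ⟨W, hW, hSW⟩ := hF S.card ⟨V, hV⟩ S le_rfl hSV
  exact ⟨W, mem_iUnion₂.2 ⟨_, _, hW⟩, hSW⟩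

theorem leIIPlus_gfin_kCovers_omegaCovers :
    (Gfin (KCovers X) (KCovers X)).LeIIPlus (Gfin (OmegaCovers X) (OmegaCovers X)) where
  toLeII := by
    by_cases hX : CompactSpace X
    · exact .of_iiWinsMark iiWinsMark_gfin_omegaCovers
    · have := not_compactSpace_iff.1 hX
      exact leII_gfin_kCovers_omegaCovers_of_noncompactSpace
  notCnst := by
    simpa only [not_iWinsCnst_iff_lindelofFor] using LindelofFor.omegaCovers_of_kCovers

theorem leIIPlus_gfin_omegaCovers_openCovers :
    (Gfin (OmegaCovers X) (OmegaCovers X)).LeIIPlus (Gfin (OpenCovers X) (OpenCovers X)) := by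
  classical
  have hanswer : ∀ (a : (Gfin (OpenCovers X) (OpenCovers X)).moves), ∀ V ∈ finiteUnions a.1,
      ∃ F : Finset (Set X), (F : Set (Set X)) ⊆ a ∧ V = ⋃₀ (F : Set (Set X)) :=
    fun a V hV => hV
  choose! u hua hu using hanswer
  have hlegal : ∀ a (F : Finset (Set X)), (F : Set (Set X)) ⊆ finiteUnions a.1 →
      (F.biUnion (u a) : Set (Set X)) ⊆ a := fun a F hF => by
    simpa only [Finset.coe_biUnion, iUnion_subset_iff] using fun V hV => hua a V (hF hV)
  refine Translation.leIIPlus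
    { move := fun _ a =>
        ⟨finiteUnions a.1, kCovers_subset_omegaCovers (finiteUnions_mem_kCovers a.2)⟩
      answer := fun _ a F => F.biUnion (u a)
      answer_subset := fun _ => hlegal
      won := fun A F hF hwon => ⟨fun U hU => ?_, eq_univ_of_forall fun x => ?_⟩ }
    fun _ => rfl
  · obtain ⟨n, hn⟩ := mem_iUnion.1 hU
    exact (A n).2.1 U (hlegal _ _ (hF n) hn)
  · obtain ⟨V, hV, hxV⟩ := mem_sUnion.1 (hwon.1.2.ge (mem_univ x))
    obtain ⟨n, hn⟩ := mem_iUnion.1 hV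
    rw [hu (A n) V (hF n hn)] at hxV
    obtain ⟨W, hW, hxW⟩ := hxV
    exact ⟨W, mem_iUnion.2 ⟨n, Finset.mem_biUnion.2 ⟨V, hn, hW⟩⟩, hxW⟩

end Comparison

theorem mainTheorem1 (X : Type*) [TopologicalSpace X] :
    ((Gfin (KCovers X) (KCovers X)).LeIIPlus (Gfin (OmegaCovers X) (OmegaCovers X)) ∧
      (Gfin (OmegaCovers X) (OmegaCovers X)).LeIIPlus (Gfin (OpenCovers X) (OpenCovers X))) ∧
    ((Sfin (KCovers X) (KCovers X) → Sfin (OmegaCovers X) (OmegaCovers X)) ∧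
      (Sfin (OmegaCovers X) (OmegaCovers X) → Sfin (OpenCovers X) (OpenCovers X))) ∧
    ((LindelofFor (KCovers X) → LindelofFor (OmegaCovers X)) ∧
      (LindelofFor (OmegaCovers X) → LindelofFor (OpenCovers X))) := by
  have hKΩ := leIIPlus_gfin_kCovers_omegaCovers (X := X)
  have hΩO := leIIPlus_gfin_omegaCovers_openCovers (X := X)
  exact ⟨⟨hKΩ, hΩO⟩, ⟨hKΩ.sfin, hΩO.sfin⟩, hKΩ.lindelofFor, hΩO.lindelofFor⟩
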